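/- Let $K$ be a number field with algebraic closure $\overline K$, let $c\in K$, $c\neq 0$, and let $E_2$ be the elliptic curve $y^2=x^3+c$. Let $\zeta_3,\zeta_7\in\overline K$ be primitive roots of unity of orders $3$ and $7$, let $\phi_2$ be the map $(x,y)\mapsto(\zeta_3x,y)$ on $E_2(\overline K)$ (fixing the point at infinity), and let $K_7=K(E_2[7])$ be the field generated over $K$ by the coordinates of the affine points $P\in E_2(\overline K)$ with $7P=O$. Put \[ \begin{aligned} \delta_1&=-\big((-132\zeta_3-120)\zeta_7^5+(-168\zeta_3-12)\zeta_7^4+(-24\zeta_3+60)\zeta_7^3+(-60\zeta_3-84)\zeta_7^2+(-192\zeta_3-96)\zeta_7-96\zeta_3+52\big),\\ \delta_2&=-\big((-24\zeta_3-84)\zeta_7^5+(36\zeta_3-108)\zeta_7^4+(108\zeta_3-72)\zeta_7^3+(168\zeta_3+12)\zeta_7^2+(144\zeta_3+72)\zeta_7+72\zeta_3+64\big),\\ \delta_3&=-\big((108\zeta_3+180)\zeta_7^5+(-60\zeta_3+24)\zeta_7^4+(132\zeta_3+120)\zeta_7^3+(-36\zeta_3+108)\zeta_7^2+(72\zeta_3+36)\zeta_7+36\zeta_3+172\big),\\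 \delta_4&=-\big((132\zeta_3+12)\zeta_7^5+(168\zeta_3+156)\zeta_7^4+(24\zeta_3+84)\zeta_7^3+(60\zeta_3-24)\zeta_7^2+(192\zeta_3+96)\zeta_7+96\zeta_3+148\big),\\ \delta_5&=-\big((24\zeta_3-60)\zeta_7^5+(-36\zeta_3-144)\zeta_7^4+(-108\zeta_3-180)\zeta_7^3+(-168\zeta_3-156)\zeta_7^2+(-144\zeta_3-72)\zeta_7-72\zeta_3-8\big),\\ \delta_6&=-\big((-108\zeta_3+72)\zeta_7^5+(60\zeta_3+84)\zeta_7^4+(-132\zeta_3-12)\zeta_7^3+(36\zeta_3+144)\zeta_7^2+(-72\zeta_3-36)\zeta_7-36\zeta_3+136\big). \end{aligned} \] Let $1\le j\le 6$, and let $\sqrt[3]{\delta_jc}$ and $\sqrt{(\delta_j+1)c}$ be any cube root of $\delta_jc$ and any square root of $(\delta_j+1)c$ in $\overline K$. Then \[ K_7=K\big(\sqrt[3]{\delta_jc},\ \zeta_3,\ \sqrt{(\delta_j+1)c}\big)=K\big(\sqrt[3]{\delta_jc},\ \zeta_7,\ \sqrt{(\delta_j+1)c}\big). \] Moreover, $\sqrt[3]{\delta_jc}$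 is a root of the $7$-th division polynomial of $E_2$, and $P_j=\big(\sqrt[3]{\delta_jc},\sqrt{(\delta_j+1)c}\big)$ is a point of $E_2$ such that $P_j$ and $\phi_2(P_j)$ form a basis of $E_2[7]$ over $\mathbb Z/7\mathbb Z$; in particular they are independent. -/

import Mathlib

namespace DivisionField

open WeierstrassCurve

/-- The Weierstrass curve `y² = x³ + c`. -/
def curve {R : Type*} [CommRing R] (c : R) : WeierstrassCurve R where
  a₁ := 0
  a₂ := 0
  a₃ := 0
  a₄ := 0
  a₆ := c

/-- The group `W(L)` of `L`-rational points of a Weierstrass curve `W` over `K`. -/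
abbrev PointsOver {K : Type*} [Field K] (W : WeierstrassCurve K)
    (L : Type*) [Field L] [Algebra K L] : Type _ :=
  (W.baseChange L).toAffine.Point

/-- The set of the coordinates of the affine `m`-torsion points of `W(L)`. -/
def torsionCoordinates {K : Type*} [Field K] (W : WeierstrassCurve K)
    (L : Type*) [Field L] [DecidableEq L] [Algebra K L] (m : ℕ) : Set L :=
  {t | ∃ (x y : L) (h : (W.baseChange L).toAffine.Nonsingular x y),
    m • (Affine.Point.some x y h : PointsOver W L) = 0 ∧ (t = x ∨ t = y)}

/-- The `m`-th division field `K(W[m])`, as a subfield of `L` (an algebraic closure of `K`). -/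
def divisionField {K : Type*} [Field K] (W : WeierstrassCurve K)
    (L : Type*) [Field L] [DecidableEq L] [Algebra K L] (m : ℕ) : IntermediateField K L :=
  IntermediateField.adjoin K (torsionCoordinates W L m)

/-- The elements `δ₁, …, δ₆`, in this order (`delta a b 0` is `δ₁`), for `a = ζ₃` and `b = ζ₇`. -/
def delta {R : Type*} [CommRing R] (a b : R) : Fin 6 → R :=
  ![-((-132 * a - 120) * b ^ 5 + (-168 * a - 12) * b ^ 4 + (-24 * a + 60) * b ^ 3
        + (-60 * a - 84) * b ^ 2 + (-192 * a - 96) * b - 96 * a + 52),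
    -((-24 * a - 84) * b ^ 5 + (36 * a - 108) * b ^ 4 + (108 * a - 72) * b ^ 3
        + (168 * a + 12) * b ^ 2 + (144 * a + 72) * b + 72 * a + 64),
    -((108 * a + 180) * b ^ 5 + (-60 * a + 24) * b ^ 4 + (132 * a + 120) * b ^ 3
        + (-36 * a + 108) * b ^ 2 + (72 * a + 36) * b + 36 * a + 172),
    -((132 * a + 12) * b ^ 5 + (168 * a + 156) * b ^ 4 + (24 * a + 84) * b ^ 3
        + (60 * a - 24) * b ^ 2 + (192 * a + 96) * b + 96 * a + 148),
    -((24 * a - 60) * b ^ 5 + (-36 * a - 144) * b ^ 4 + (-108 * a - 180) * b ^ 3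
        + (-168 * a - 156) * b ^ 2 + (-144 * a - 72) * b - 72 * a - 8),
    -((-108 * a + 72) * b ^ 5 + (60 * a + 84) * b ^ 4 + (-132 * a - 12) * b ^ 3
        + (36 * a + 144) * b ^ 2 + (-72 * a - 36) * b - 36 * a + 136)]

/-- If `ω³ = 1` and `(x, y)` is a nonsingular point of `y² = x³ + c`, then so is `(ω x, y)`. -/
theorem nonsingular_mul {K L : Type*} [Field K] [Field L] [Algebra K L] {c : K} {ω : L}
    (hω : ω ^ 3 = 1) {x y : L}
    (h : ((curve c).baseChange L).toAffine.Nonsingular x y) :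
    ((curve c).baseChange L).toAffine.Nonsingular (ω * x) y := by
  have h0 : ω ≠ 0 := by
    rintro rfl
    norm_num at hω
  rw [Affine.nonsingular_iff, Affine.equation_iff] at h ⊢
  simp only [curve, WeierstrassCurve.baseChange, WeierstrassCurve.map_a₁,
    WeierstrassCurve.map_a₂, WeierstrassCurve.map_a₃, WeierstrassCurve.map_a₄,
    WeierstrassCurve.map_a₆, map_zero, zero_mul, add_zero, mul_zero, sub_zero] at h ⊢
  refine ⟨?_, ?_⟩
  · rw [h.1, mul_pow, hω, one_mul]
  · rcases h.2 with h2 | h2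
    · left
      intro h3
      apply h2
      have h4 : ω ^ 2 * (3 * x ^ 2) = 0 := by linear_combination -h3
      rcases mul_eq_zero.1 h4 with h5 | h5
      · exact absurd h5 (pow_ne_zero 2 h0)
      · exact h5.symm
    · exact Or.inr h2

/-- The map `(x, y) ↦ (ω x, y)` on the points of `y² = x³ + c`, for `ω³ = 1`, fixing the point at
infinity: for `ω = ζ₃` it is the complex multiplication by `ζ₃`. -/
def cm {K L : Type*} [Field K] [Field L] [Algebra K L] (c : K) (ω : L) (hω : ω ^ 3 = 1) :
    PointsOver (curve c) L → PointsOver (curve c) L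
  | Affine.Point.zero => Affine.Point.zero
  | Affine.Point.some x y h => Affine.Point.some (ω * x) y (nonsingular_mul hω h)

end DivisionField

/-! The δ_j are the images of δ₁ under ζ₇ ↦ ζ₇^e, so replacing ζ₇ by another primitive root `b`
reduces everything to δ₁ (`delta_eq_delta_zero`). For P = (x, y) with x³ = δc and y² = (δ+1)c, the
duplication formula gives 2P = (ux, vy), where u and v are rational functions of δ, hence elements
of ℚ(ζ₃, ζ₇). The crucial identity is δ(b)u³ = δ(b⁴) (`delta_pow_four`): doubling P amounts to
applying b ↦ b⁴. Since 4 has order 3 modulo 7, three doublings return to the same δ, and the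
products of the three u's and of the three v's equal 1. Hence 8P = P and 7P = 0.

Independence of P and φ₂(P) means that φ₂(P) is no multiple kP. Up to sign, k is 0, 1, 2 or 4 modulo
7, and apart from k = 0 each case forces a relation between abscissas that would make ζ₃ = 1 or the
cube of some u equal to 1; neither holds. The seventh division polynomial has degree at most 24 and
each root carries at most two points, so there are at most 1 + 2·24 = 49 torsion points, and P,
φ₂(P) generate all of them.

Thus K₇ is generated by x, ζ₃x and y, that is, by x, ζ₃ and y. Since δ = x³/c, trading ζ₃ for ζ₇
amounts to recovering each root of unity from δ and the other one: ζ₃ because δ is linear in it with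
invertible coefficient, ζ₇ as a combination of the ratios u, v and their conjugates. -/

namespace DivisionField

open WeierstrassCurve

/-! ### Group law on y² = x³ + c and the seventh division polynomial -/

section Points

variable {K L : Type*} [Field K] [Field L] [DecidableEq L] [Algebra K L] {c : K}

omit [DecidableEq L] in
theorem equation_curve_iff {x y : L} :
    ((curve c).baseChange L).toAffine.Equation x y ↔ y ^ 2 = x ^ 3 + algebraMap K L c := by
  rw [Affine.equation_iff]
  simp [curve, WeierstrassCurve.baseChange]

omit [DecidableEq L] in
theorem nonsingular_curve_iff [CharZero L] (hc : c ≠ 0) {x y : L} :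
    ((curve c).baseChange L).toAffine.Nonsingular x y ↔ y ^ 2 = x ^ 3 + algebraMap K L c := by
  rw [Affine.nonsingular_iff, equation_curve_iff]
  simp only [curve, WeierstrassCurve.baseChange, WeierstrassCurve.map_a₁,
    WeierstrassCurve.map_a₂, WeierstrassCurve.map_a₃, WeierstrassCurve.map_a₄, map_zero, zero_mul,
    add_zero, mul_zero, sub_zero]
  refine ⟨fun h ↦ h.1, fun h ↦ ⟨h, ?_⟩⟩
  by_contra! h'
  have hx : x = 0 := by simpa using h'.1.symm
  have hy : y = 0 := self_eq_neg.1 h'.2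
  have : algebraMap K L c = 0 := by rw [hx, hy] at h; simpa using h.symm
  exact hc (by simpa using this)

omit [DecidableEq L] in
theorem negY_curve (x y : L) : ((curve c).baseChange L).toAffine.negY x y = -y := by
  simp [Affine.negY, curve, WeierstrassCurve.baseChange]

/-- Addition of two points with distinct abscissas, the slope of the chord being `l`. -/
theorem add_some_of_ne {x₁ y₁ x₂ y₂ l x₃ y₃ : L}
    (h₁ : ((curve c).baseChange L).toAffine.Nonsingular x₁ y₁)
    (h₂ : ((curve c).baseChange L).toAffine.Nonsingular x₂ y₂) (hx : x₁ ≠ x₂)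
    (hl : l * (x₁ - x₂) = y₁ - y₂) (h₃ : x₃ = l ^ 2 - x₁ - x₂) (h₄ : y₃ = l * (x₁ - x₃) - y₁) :
    ∃ h : ((curve c).baseChange L).toAffine.Nonsingular x₃ y₃,
      (Affine.Point.some x₁ y₁ h₁ + Affine.Point.some x₂ y₂ h₂ : PointsOver (curve c) L)
        = Affine.Point.some x₃ y₃ h := by
  have hs : ((curve c).baseChange L).toAffine.slope x₁ x₂ y₁ y₂ = l := by
    rw [Affine.slope_of_X_ne hx, ← hl, mul_div_cancel_right₀ _ (sub_ne_zero.2 hx)]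
  have hX : ((curve c).baseChange L).toAffine.addX x₁ x₂ l = x₃ := by
    simp [Affine.addX, curve, WeierstrassCurve.baseChange, h₃]
  have hY : ((curve c).baseChange L).toAffine.addY x₁ x₂ y₁ l = y₃ := by
    rw [Affine.addY, negY_curve, Affine.negAddY, hX, h₄]
    ring
  have key := Affine.Point.add_of_X_ne (h₁ := h₁) (h₂ := h₂) hx
  have hn := Affine.nonsingular_add h₁ h₂ fun h ↦ hx h.1
  simp only [hs, hX, hY] at key hn
  exact ⟨hn, key⟩

/-- Doubling of a point of order different from `2`, the slope of the tangent being `l`. -/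
theorem two_nsmul_some {x y l x₃ y₃ : L} [CharZero L]
    (h₁ : ((curve c).baseChange L).toAffine.Nonsingular x y) (hy : y ≠ 0)
    (hl : l * (2 * y) = 3 * x ^ 2) (h₃ : x₃ = l ^ 2 - 2 * x) (h₄ : y₃ = l * (x - x₃) - y) :
    ∃ h : ((curve c).baseChange L).toAffine.Nonsingular x₃ y₃,
      2 • (Affine.Point.some x y h₁ : PointsOver (curve c) L) = Affine.Point.some x₃ y₃ h := by
  have hy' : y ≠ ((curve c).baseChange L).toAffine.negY x y := by
    rw [negY_curve]
    exact fun h ↦ hy (self_eq_neg.1 h)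
  have hs : ((curve c).baseChange L).toAffine.slope x x y y = l := by
    rw [Affine.slope_of_Y_ne rfl hy', negY_curve, sub_neg_eq_add, ← two_mul,
      div_eq_iff (mul_ne_zero two_ne_zero hy), hl]
    simp [curve, WeierstrassCurve.baseChange]
  have hX : ((curve c).baseChange L).toAffine.addX x x l = x₃ := by
    simp only [Affine.addX, curve, WeierstrassCurve.baseChange, WeierstrassCurve.map_a₁,
      WeierstrassCurve.map_a₂, map_zero, h₃]
    ring
  have hY : ((curve c).baseChange L).toAffine.addY x x y l = y₃ := by
    rw [Affine.addY, negY_curve, Affine.negAddY, hX, h₄]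
    ring
  have key := Affine.Point.add_self_of_Y_ne (h₁ := h₁) hy'
  have hn := Affine.nonsingular_add h₁ h₁ fun h ↦ hy' h.2
  simp only [hs, hX, hY] at key hn
  exact ⟨hn, by rw [two_nsmul]; exact key⟩

theorem two_nsmul_some_of_eq_zero {x y : L}
    (h₁ : ((curve c).baseChange L).toAffine.Nonsingular x y) (hy : y = 0) :
    2 • (Affine.Point.some x y h₁ : PointsOver (curve c) L) = 0 := by
  rw [two_nsmul]
  exact Affine.Point.add_self_of_Y_eq (by rw [negY_curve, hy, neg_zero])

omit [DecidableEq L] in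
/-- The value at `x` of the seventh division polynomial of `y² = x³ + c`. -/
theorem eval_preΨ'_seven (x : L) :
    (((curve c).baseChange L).preΨ' 7).eval x =
      7 * x ^ 24 + 3944 * algebraMap K L c * x ^ 21 - 42896 * algebraMap K L c ^ 2 * x ^ 18
        - 829696 * algebraMap K L c ^ 3 * x ^ 15 - 928256 * algebraMap K L c ^ 4 * x ^ 12
        - 1555456 * algebraMap K L c ^ 5 * x ^ 9 - 2809856 * algebraMap K L c ^ 6 * x ^ 6
        - 802816 * algebraMap K L c ^ 7 * x ^ 3 + 65536 * algebraMap K L c ^ 8 := by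
  have h5 := ((curve c).baseChange L).preΨ'_odd 0
  have h7 := ((curve c).baseChange L).preΨ'_odd 1
  norm_num at h5 h7
  rw [h7, h5]
  simp [Ψ₃, preΨ₄, Ψ₂Sq, WeierstrassCurve.b₂, WeierstrassCurve.b₄, WeierstrassCurve.b₆,
    WeierstrassCurve.b₈, curve, WeierstrassCurve.baseChange]
  ring

/-- The abscissa of an affine `7`-torsion point is a root of the seventh division polynomial. -/
theorem eval_preΨ'_seven_eq_zero [CharZero L] {x y : L}
    (h : ((curve c).baseChange L).toAffine.Nonsingular x y)
    (h7 : 7 • (Affine.Point.some x y h : PointsOver (curve c) L) = 0) :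
    (((curve c).baseChange L).preΨ' 7).eval x = 0 := by
  rw [eval_preΨ'_seven]
  have hE := equation_curve_iff.1 h.1
  set C := algebraMap K L c
  obtain ⟨T, hT⟩ : ∃ T : PointsOver (curve c) L, T = Affine.Point.some x y h := ⟨_, rfl⟩
  rw [← hT] at h7
  have hT0 : T ≠ 0 := hT ▸ Affine.Point.some_ne_zero h
  have hy : y ≠ 0 := fun hy ↦ hT0 <| by
    have h2 : 2 • T = 0 := hT ▸ two_nsmul_some_of_eq_zero h hy
    calc T = 7 • T - 3 • 2 • T := by module
      _ = 0 := by rw [h7, h2]; simp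
  obtain ⟨x₂, hx₂⟩ : ∃ x₂, x₂ = (3 * x ^ 2 / (2 * y)) ^ 2 - 2 * x := ⟨_, rfl⟩
  obtain ⟨y₂, hy₂⟩ : ∃ y₂, y₂ = 3 * x ^ 2 / (2 * y) * (x - x₂) - y := ⟨_, rfl⟩
  obtain ⟨h2, hd⟩ := two_nsmul_some h hy (by field_simp) hx₂ hy₂
  rw [← hT] at hd
  have hy₂0 : y₂ ≠ 0 := fun hy ↦ hT0 <| by
    have h4 := two_nsmul_some_of_eq_zero h2 hy
    rw [← hd] at h4
    calc T = 2 • 2 • 2 • T - 7 • T := by module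
      _ = 0 := by rw [h7, h4]; simp
  -- Otherwise 2T = ±T, so T or 3T vanishes, which is incompatible with 7T = 0 and T ≠ 0.
  have hne : x ≠ x₂ := fun hx ↦ hT0 <| by
    have : 2 • T = T ∨ 2 • T = -T := by rw [hd, hT]; exact Affine.Point.X_eq_iff.1 hx.symm
    rcases this with h' | h'
    · calc T = 2 • T - T := by module
        _ = 0 := by rw [h']; simp
    · have h3 : 3 • T = 0 := by
        calc 3 • T = 2 • T + T := by module
          _ = 0 := by rw [h']; simp
      calc T = 7 • T - 2 • 3 • T := by module
        _ = 0 := by rw [h7, h3]; simp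
  obtain ⟨h3, ht⟩ := add_some_of_ne (l := (y - y₂) / (x - x₂)) h h2 hne
    (div_mul_cancel₀ _ (sub_ne_zero.2 hne)) rfl rfl
  obtain ⟨h4, hq⟩ := two_nsmul_some (l := 3 * x₂ ^ 2 / (2 * y₂)) h2 hy₂0 (by field_simp) rfl rfl
  -- From 7T = 0 one gets 3T = -4T, so 3T and 4T share their abscissa; the rest clears denominators
  -- in this equality.
  have hx34 : ((y - y₂) / (x - x₂)) ^ 2 - x - x₂ = (3 * x₂ ^ 2 / (2 * y₂)) ^ 2 - 2 * x₂ := by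
    refine Affine.Point.X_eq_iff (h₁ := h3) (h₂ := h4) |>.2 (Or.inr ?_)
    rw [← ht, ← hq, ← hd, ← hT]
    calc T + 2 • T = 7 • T - 2 • 2 • T := by module
      _ = _ := by rw [h7]; simp
  have e2 : y₂ ^ 2 = x₂ ^ 3 + C := equation_curve_iff.1 h2.1
  have a2 : 4 * y ^ 2 * x₂ = x * (x ^ 3 - 8 * C) := by
    rw [hx₂]
    field_simp
    linear_combination (-32 * x) * hE
  have b2 : 8 * y ^ 3 * y₂ = x ^ 6 + 20 * C * x ^ 3 - 8 * C ^ 2 := by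
    have : 2 * y * y₂ = 3 * x ^ 2 * (x - x₂) - 2 * y ^ 2 := by
      rw [hy₂]; field_simp
    linear_combination 4 * y ^ 2 * this - 3 * x ^ 2 * a2
      + (12 * x ^ 3 - 8 * (y ^ 2 + x ^ 3 + C)) * hE
  obtain ⟨N, hN⟩ : ∃ N, N = x ^ 6 + 20 * C * x ^ 3 - 8 * C ^ 2 := ⟨_, rfl⟩
  obtain ⟨A, hA⟩ : ∃ A, A = x * (x ^ 3 - 8 * C) := ⟨_, rfl⟩
  -- `Q` is the third division polynomial; `A` and `N` are the numerators of the coordinates of 2T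
  -- over 4y² and 8y³.
  obtain ⟨Q, hQ⟩ : ∃ Q, Q = 3 * x ^ 4 + 12 * C * x := ⟨_, rfl⟩
  rw [← hN] at b2
  rw [← hA] at a2
  have s1 : (x - x₂) * (4 * y ^ 2) = Q := by
    rw [hQ]; linear_combination 4 * x * hE - a2 - hA
  have s2 : (y - y₂) * (8 * y ^ 3) = 8 * y ^ 4 - N := by linear_combination -b2
  obtain ⟨m, hm⟩ : ∃ m, m = (y - y₂) / (x - x₂) := ⟨_, rfl⟩
  obtain ⟨l, hl⟩ : ∃ l, l = 3 * x₂ ^ 2 / (2 * y₂) := ⟨_, rfl⟩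
  have hm' : m * (x - x₂) = y - y₂ := by
    rw [hm, div_mul_cancel₀ _ (sub_ne_zero.2 hne)]
  have hl' : l * (2 * y₂) = 3 * x₂ ^ 2 := by rw [hl]; field_simp
  rw [← hm, ← hl] at hx34
  have s3 : 4 * y ^ 2 * (Q ^ 2 * (m ^ 2 - x - x₂)) =
      (8 * y ^ 4 - N) ^ 2 - (4 * x * y ^ 2 + A) * Q ^ 2 := by
    rw [← s1, ← s2, ← hm', ← a2]; ring
  have s4 : Q ^ 2 * (m ^ 2 - x - x₂) = x ^ 9 - 96 * C * x ^ 6 + 48 * C ^ 2 * x ^ 3 + 64 * C ^ 3 := by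
    have h4y : 4 * y ^ 2 ≠ 0 := mul_ne_zero (by norm_num) (pow_ne_zero 2 hy)
    apply mul_left_cancel₀ h4y
    rw [s3, hN, hA, hQ, show y ^ 4 = (y ^ 2) ^ 2 by ring, hE]
    ring
  have s5 : 16 * y ^ 2 * N ^ 2 * (l ^ 2 - 2 * x₂) = A ^ 4 - 512 * C * A * (y ^ 2) ^ 3 := by
    have : 4 * y₂ ^ 2 * (l ^ 2 - 2 * x₂) = x₂ ^ 4 - 8 * C * x₂ := by
      linear_combination (l * (2 * y₂) + 3 * x₂ ^ 2) * hl' - 8 * x₂ * e2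
    rw [← a2, ← b2]
    linear_combination 256 * y ^ 8 * this
  rw [← hx34, hE] at s5
  -- Cross-multiplied form of x(3T) = x(4T). The difference of the two sides is exactly the seventh
  -- division polynomial, with leading coefficient 16 - 9 = 7.
  have s6 : 16 * (x ^ 3 + C) * N ^ 2 *
      (x ^ 9 - 96 * C * x ^ 6 + 48 * C ^ 2 * x ^ 3 + 64 * C ^ 3) =
      Q ^ 2 * (A ^ 4 - 512 * C * A * (x ^ 3 + C) ^ 3) := by
    rw [← s4]; linear_combination Q ^ 2 * s5
  rw [hN, hA, hQ] at s6
  linear_combination s6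

end Points

/-! ### Identities in ℤ[ζ₃, ζ₇], certified by cofactors of 1 + a + a² and 1 + b + ⋯ + b⁶ -/

section Ratios

/-- The ratio of the abscissas of `2P` and `P`, where `P = (x, y)` and `x³ = δ₁ c`. -/
def xRatio {R : Type*} [CommRing R] (a b : R) : R :=
  a * b ^ 5 - 2 * a * b ^ 4 + 2 * a * b ^ 3 - a * b ^ 2 + 2 * b ^ 5 - b ^ 4 + b ^ 3 + b ^ 2 + 1

/-- The ratio of the ordinates of `2P` and `P`, where `P = (x, y)` and `x³ = δ₁ c`. -/
def yRatio {R : Type*} [CommRing R] (a b : R) : R :=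
  -10 * a * b ^ 5 + 2 * a * b ^ 4 - 10 * a * b ^ 3 + 2 * a * b ^ 2 - 8 * a * b - 4 * a - 14 * b ^ 5
      - 4 * b ^ 4 - 10 * b ^ 3 - 8 * b ^ 2 - 4 * b - 15

/-- The exponent of `ζ₇` under which `δ₁` becomes `delta a b j`. -/
def deltaExponent : Fin 6 → ℕ := ![1, 5, 4, 6, 2, 3]

theorem deltaExponent_coprime (j : Fin 6) : (deltaExponent j).Coprime 7 := by
  fin_cases j <;> decide

variable {R : Type*} [CommRing R] {a b : R}

/-- The six constants are conjugate under the substitutions b ↦ b^e, so only δ₁ has to be studied,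
for an arbitrary primitive seventh root. -/
theorem delta_eq_delta_zero (hb : 1 + b + b ^ 2 + b ^ 3 + b ^ 4 + b ^ 5 + b ^ 6 = 0) (j : Fin 6) :
    delta a b j = delta a (b ^ deltaExponent j) 0 := by
  fin_cases j <;> simp [delta, deltaExponent]
  · linear_combination (-132 * a * b ^ 19 + 132 * a * b ^ 18 - 168 * a * b ^ 14 + 168 * a * b ^ 13
      - 132 * a * b ^ 12 + 132 * a * b ^ 11 - 24 * a * b ^ 9 + 24 * a * b ^ 8 - 168 * a * b ^ 7 +
      168 * a * b ^ 6 - 132 * a * b ^ 5 + 72 * a * b ^ 4 + 60 * a * b ^ 3 - 24 * a * b ^ 2 + 24 * a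
      * b - 168 * a - 120 * b ^ 19 + 120 * b ^ 18 - 12 * b ^ 14 + 12 * b ^ 13 - 120 * b ^ 12 + 120
      * b ^ 11 + 60 * b ^ 9 - 60 * b ^ 8 - 12 * b ^ 7 + 12 * b ^ 6 - 120 * b ^ 5 + 36 * b ^ 4 + 84
      * b ^ 3 + 60 * b ^ 2 - 60 * b - 12) * hb
  · linear_combination (-132 * a * b ^ 14 + 132 * a * b ^ 13 - 168 * a * b ^ 10 + 168 * a * b ^ 9 -
      132 * a * b ^ 7 + 108 * a * b ^ 6 + 24 * a * b ^ 5 - 168 * a * b ^ 3 + 108 * a * b ^ 2 + 60 *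
      a * b - 132 * a - 120 * b ^ 14 + 120 * b ^ 13 - 12 * b ^ 10 + 12 * b ^ 9 - 120 * b ^ 7 + 180
      * b ^ 6 - 60 * b ^ 5 - 12 * b ^ 3 - 72 * b ^ 2 + 84 * b - 120) * hb
  · linear_combination (-132 * a * b ^ 24 + 132 * a * b ^ 23 - 168 * a * b ^ 18 + 36 * a * b ^ 17 +
      132 * a * b ^ 16 - 24 * a * b ^ 12 - 144 * a * b ^ 11 + 36 * a * b ^ 10 + 132 * a * b ^ 9 -
      60 * a * b ^ 6 + 36 * a * b ^ 5 - 144 * a * b ^ 4 + 36 * a * b ^ 3 + 132 * a * b ^ 2 - 192 *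
      a - 120 * b ^ 24 + 120 * b ^ 23 - 12 * b ^ 18 - 108 * b ^ 17 + 120 * b ^ 16 + 60 * b ^ 12 -
      72 * b ^ 11 - 108 * b ^ 10 + 120 * b ^ 9 - 84 * b ^ 6 + 144 * b ^ 5 - 72 * b ^ 4 - 108 * b ^
      3 + 120 * b ^ 2 - 96) * hb
  · linear_combination (-132 * a * b ^ 4 + 132 * a * b ^ 3 - 168 * a * b ^ 2 + 168 * a * b - 24 * a
      - 120 * b ^ 4 + 120 * b ^ 3 - 12 * b ^ 2 + 12 * b + 60) * hb
  · linear_combination (-132 * a * b ^ 9 + 132 * a * b ^ 8 - 168 * a * b ^ 6 + 168 * a * b ^ 5 - 24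
      * a * b ^ 3 - 108 * a * b ^ 2 + 132 * a * b - 60 * a - 120 * b ^ 9 + 120 * b ^ 8 - 12 * b ^ 6
      + 12 * b ^ 5 + 60 * b ^ 3 - 180 * b ^ 2 + 120 * b - 84) * hb

/-- Duplication reads x(2P)/x = (x³ - 8c)/(4y²); substitute x³ = δc and y² = (δ+1)c. -/
theorem xRatio_spec (ha : 1 + a + a ^ 2 = 0) (hb : 1 + b + b ^ 2 + b ^ 3 + b ^ 4 + b ^ 5 + b ^ 6 =
    0) :
    4 * (delta a b 0 + 1) * xRatio a b = delta a b 0 - 8 := by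
  simp only [delta, Matrix.cons_val_zero, xRatio]
  linear_combination (-576 * b ^ 5 + 720 * b ^ 4 + 720 * b ^ 3 - 576 * b ^ 2 + 1056) * ha + (528 *
      a ^ 2 * b ^ 4 - 912 * a ^ 2 * b ^ 3 + 192 * a ^ 2 * b ^ 2 + 1056 * a ^ 2 * b - 1056 * a ^ 2 +
      1536 * a * b ^ 4 - 1632 * a * b ^ 3 + 768 * a * b ^ 2 + 1344 * a * b - 768 * a + 960 * b ^ 4
      - 1344 * b ^ 3 + 336 * b ^ 2 + 1488 * b - 1200) * hb

/-- The tangent at P gives 2y·y(2P) = 3x²(x - x(2P)) - 2y²; divide by c. -/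
theorem yRatio_spec (ha : 1 + a + a ^ 2 = 0) (hb : 1 + b + b ^ 2 + b ^ 3 + b ^ 4 + b ^ 5 + b ^ 6 =
    0) :
    2 * (delta a b 0 + 1) * yRatio a b =
      -2 * (delta a b 0 + 1) - 3 * delta a b 0 * (xRatio a b - 1) := by
  simp only [delta, Matrix.cons_val_zero, xRatio, yRatio]
  linear_combination (-912 * b ^ 5 + 1116 * b ^ 4 + 1116 * b ^ 3 - 912 * b ^ 2 + 1608) * ha +
      (-2244 * a ^ 2 * b ^ 4 - 876 * a ^ 2 * b ^ 3 + 528 * a ^ 2 * b ^ 2 - 696 * a ^ 2 * b - 2376 *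
      a ^ 2 - 4944 * a * b ^ 4 - 648 * a * b ^ 3 + 288 * a * b ^ 2 - 2208 * a * b - 3888 * a - 2640
      * b ^ 4 + 1056 * b ^ 3 + 732 * b ^ 2 - 2100 * b - 180) * hb

/-- The heart of the computation: 2P is again a point of the same shape, with b⁴ in place of b, so
doubling can be iterated. -/
theorem delta_pow_four (ha : 1 + a + a ^ 2 = 0) (hb : 1 + b + b ^ 2 + b ^ 3 + b ^ 4 + b ^ 5 + b ^ 6
    = 0) :
    delta a (b ^ 4) 0 = delta a b 0 * xRatio a b ^ 3 := by
  simp only [delta, Matrix.cons_val_zero, xRatio]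
  linear_combination (-684 * a ^ 2 * b ^ 5 + 948 * a ^ 2 * b ^ 4 + 948 * a ^ 2 * b ^ 3 - 684 * a ^
      2 * b ^ 2 + 1404 * a ^ 2 - 2932 * a * b ^ 5 - 1676 * a * b ^ 4 + 532 * a * b ^ 3 - 1476 * a *
      b ^ 2 - 3040 * a * b - 116 * a - 1088 * b ^ 5 - 1600 * b ^ 4 - 496 * b ^ 3 - 360 * b ^ 2 -
      1520 * b - 1264) * ha + (-132 * a ^ 4 * b ^ 14 + 756 * a ^ 4 * b ^ 13 - 2016 * a ^ 4 * b ^ 12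
      + 3072 * a ^ 4 * b ^ 11 - 2400 * a ^ 4 * b ^ 10 - 192 * a ^ 4 * b ^ 9 + 2424 * a ^ 4 * b ^ 8
      - 1884 * a ^ 4 * b ^ 7 - 588 * a ^ 4 * b ^ 6 + 1632 * a ^ 4 * b ^ 5 - 1632 * a ^ 4 * b ^ 3 +
      684 * a ^ 4 * b ^ 2 + 1404 * a ^ 4 * b - 1404 * a ^ 4 - 912 * a ^ 3 * b ^ 14 + 4176 * a ^ 3 *
      b ^ 13 - 9216 * a ^ 3 * b ^ 12 + 11472 * a ^ 3 * b ^ 11 - 6672 * a ^ 3 * b ^ 10 - 1976 * a ^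
      3 * b ^ 9 + 5768 * a ^ 3 * b ^ 8 - 1152 * a ^ 3 * b ^ 7 - 4712 * a ^ 3 * b ^ 6 + 3752 * a ^ 3
      * b ^ 5 + 1920 * a ^ 3 * b ^ 4 - 3640 * a ^ 3 * b ^ 3 - 880 * a ^ 3 * b ^ 2 + 4328 * a ^ 3 *
      b - 1288 * a ^ 3 - 2304 * a ^ 2 * b ^ 14 + 8208 * a ^ 2 * b ^ 13 - 15336 * a ^ 2 * b ^ 12 +
      15192 * a ^ 2 * b ^ 11 - 5112 * a ^ 2 * b ^ 10 - 7464 * a ^ 2 * b ^ 9 + 10704 * a ^ 2 * b ^ 8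
      - 3384 * a ^ 2 * b ^ 7 - 3576 * a ^ 2 * b ^ 6 + 2280 * a ^ 2 * b ^ 5 + 3648 * a ^ 2 * b ^ 4 -
      3792 * a ^ 2 * b ^ 3 - 1752 * a ^ 2 * b ^ 2 + 4584 * a ^ 2 * b - 24 * a ^ 2 - 2364 * a * b ^
      14 + 6780 * a * b ^ 13 - 11376 * a * b ^ 12 + 7152 * a * b ^ 11 + 2424 * a * b ^ 10 - 12456 *
      a * b ^ 9 + 9696 * a * b ^ 8 - 1764 * a * b ^ 7 - 5412 * a * b ^ 6 + 1824 * a * b ^ 5 + 1920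
      * a * b ^ 4 - 1656 * a * b ^ 3 - 3036 * a * b ^ 2 + 2988 * a * b + 1380 * a - 840 * b ^ 14 +
      2184 * b ^ 13 - 2880 * b ^ 12 + 48 * b ^ 11 + 3192 * b ^ 10 - 4552 * b ^ 9 + 1432 * b ^ 8 +
      1632 * b ^ 7 - 2632 * b ^ 6 + 376 * b ^ 5 + 720 * b ^ 4 - 8 * b ^ 3 - 992 * b ^ 2 + 160 * b +
      1264) * hb

theorem xRatio_pow_four (hb : 1 + b + b ^ 2 + b ^ 3 + b ^ 4 + b ^ 5 + b ^ 6 = 0) :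
    xRatio a (b ^ 4) = a * b ^ 5 - a * b ^ 4 - a * b ^ 3 - 3 * a * b ^ 2 - 2 * a * b - a - b ^ 5 -
        2 * b ^ 4 - 2 * b ^ 3 - 3 * b ^ 2 - b - 1 := by
  simp only [xRatio]
  linear_combination (a * b ^ 14 - a * b ^ 13 - 2 * a * b ^ 10 + 2 * a * b ^ 9 + a * b ^ 7 + a * b
      ^ 6 - 2 * a * b ^ 5 - 2 * a * b ^ 3 + a * b ^ 2 + a * b + a + 2 * b ^ 14 - 2 * b ^ 13 - b ^
      10 + b ^ 9 + 2 * b ^ 7 - b ^ 6 - b ^ 5 - b ^ 3 + 2 * b ^ 2 - b + 2) * hb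

theorem xRatio_pow_two (hb : 1 + b + b ^ 2 + b ^ 3 + b ^ 4 + b ^ 5 + b ^ 6 = 0) :
    xRatio a (b ^ 2) = -2 * a * b ^ 5 - 3 * a * b ^ 4 - a * b ^ 3 - 2 * a * b ^ 2 - 4 * a * b - 2 *
        a - b ^ 5 + b ^ 3 - b ^ 2 - 2 * b := by
  simp only [xRatio]
  linear_combination (a * b ^ 4 - a * b ^ 3 - 2 * a * b ^ 2 + 2 * a * b + 2 * a + 2 * b ^ 4 - 2 * b
      ^ 3 - b ^ 2 + b + 1) * hb

/-- The exponents 1, 4, 2 form the orbit of b under b ↦ b⁴; this product is the ratio of the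
abscissas of 8P and P. -/
theorem xRatio_mul_mul (ha : 1 + a + a ^ 2 = 0) (hb : 1 + b + b ^ 2 + b ^ 3 + b ^ 4 + b ^ 5 + b ^ 6
    = 0) :
    xRatio a b * xRatio a (b ^ 4) * xRatio a (b ^ 2) = 1 := by
  rw [xRatio_pow_four hb, xRatio_pow_two hb, xRatio]
  linear_combination (2 * a * b ^ 4 + 2 * a * b ^ 2 + 2 * a * b + a + b ^ 4 + b ^ 2 + b - 3) * ha +
      (-2 * a ^ 3 * b ^ 9 + 5 * a ^ 3 * b ^ 8 - a ^ 3 * b ^ 7 - 2 * a ^ 3 * b ^ 6 + 5 * a ^ 3 * b ^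
      5 - 2 * a ^ 3 * b ^ 4 - 2 * a ^ 3 * b ^ 2 - a ^ 3 * b - a ^ 3 - 3 * a ^ 2 * b ^ 9 + 9 * a ^ 2
      * b ^ 8 + 9 * a ^ 2 * b ^ 6 + 9 * a ^ 2 * b ^ 5 + 6 * a ^ 2 * b ^ 4 + 12 * a ^ 2 * b ^ 3 + 8
      * a ^ 2 * b ^ 2 + a ^ 2 * b + 4 * a ^ 2 + 3 * a * b ^ 9 + 12 * a * b ^ 8 + 3 * a * b ^ 7 + 15
      * a * b ^ 6 + 12 * a * b ^ 5 + 12 * a * b ^ 4 + 18 * a * b ^ 3 + 11 * a * b ^ 2 + a * b + 4 *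
      a + 2 * b ^ 9 + b ^ 8 - 2 * b ^ 7 + 5 * b ^ 6 + b ^ 5 + 2 * b ^ 4 + 6 * b ^ 3 + b ^ 2 - b +
      2) * hb

theorem yRatio_pow_four (hb : 1 + b + b ^ 2 + b ^ 3 + b ^ 4 + b ^ 5 + b ^ 6 = 0) :
    yRatio a (b ^ 4) = 2 * a * b ^ 4 + 10 * a * b ^ 3 + 12 * a * b ^ 2 + 12 * a * b + 6 * a + 4 * b
        ^ 5 + 10 * b ^ 4 + 14 * b ^ 3 + 10 * b ^ 2 + 6 * b - 1 := by
  simp only [yRatio]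
  linear_combination (-10 * a * b ^ 14 + 10 * a * b ^ 13 + 2 * a * b ^ 10 - 2 * a * b ^ 9 - 10 * a
      * b ^ 7 + 10 * a * b ^ 5 + 2 * a * b ^ 3 - 2 * a * b - 10 * a - 14 * b ^ 14 + 14 * b ^ 13 - 4
      * b ^ 10 + 4 * b ^ 9 - 14 * b ^ 7 + 4 * b ^ 6 + 10 * b ^ 5 - 4 * b ^ 3 - 4 * b ^ 2 + 8 * b -
      14) * hb

theorem yRatio_pow_two (hb : 1 + b + b ^ 2 + b ^ 3 + b ^ 4 + b ^ 5 + b ^ 6 = 0) :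
    yRatio a (b ^ 2) = 10 * a * b ^ 5 + 12 * a * b ^ 4 + 2 * a * b ^ 2 + 12 * a * b + 6 * a + 10 *
        b ^ 5 + 2 * b ^ 4 - 4 * b ^ 3 + 6 * b ^ 2 + 6 * b - 5 := by
  simp only [yRatio]
  linear_combination (-10 * a * b ^ 4 + 10 * a * b ^ 3 + 2 * a * b ^ 2 - 2 * a * b - 10 * a - 14 *
      b ^ 4 + 14 * b ^ 3 - 4 * b ^ 2 + 4 * b - 10) * hb

theorem yRatio_mul_mul (ha : 1 + a + a ^ 2 = 0) (hb : 1 + b + b ^ 2 + b ^ 3 + b ^ 4 + b ^ 5 + b ^ 6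
    = 0) :
    yRatio a b * yRatio a (b ^ 4) * yRatio a (b ^ 2) = 1 := by
  rw [yRatio_pow_four hb, yRatio_pow_two hb, yRatio]
  linear_combination (16 * a * b ^ 4 + 16 * a * b ^ 2 + 16 * a * b + 8 * a + 8 * b ^ 4 + 8 * b ^ 2
      + 8 * b + 4) * ha + (-200 * a ^ 3 * b ^ 8 - 1000 * a ^ 3 * b ^ 7 - 1152 * a ^ 3 * b ^ 6 -
      1048 * a ^ 3 * b ^ 5 - 856 * a ^ 3 * b ^ 4 - 800 * a ^ 3 * b ^ 3 - 1128 * a ^ 3 * b ^ 2 - 728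
      * a ^ 3 * b - 152 * a ^ 3 - 400 * a ^ 2 * b ^ 9 - 1480 * a ^ 2 * b ^ 8 - 3640 * a ^ 2 * b ^ 7
      - 3488 * a ^ 2 * b ^ 6 - 3552 * a ^ 2 * b ^ 5 - 3004 * a ^ 2 * b ^ 4 - 2960 * a ^ 2 * b ^ 3 -
      3052 * a ^ 2 * b ^ 2 - 1632 * a ^ 2 * b - 408 * a ^ 2 - 960 * a * b ^ 9 - 2552 * a * b ^ 8 -
      4280 * a * b ^ 7 - 3208 * a * b ^ 6 - 3272 * a * b ^ 5 - 2736 * a * b ^ 4 - 2696 * a * b ^ 3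
      - 2252 * a * b ^ 2 - 284 * a * b + 508 * a - 560 * b ^ 9 - 1112 * b ^ 8 - 1176 * b ^ 7 - 696
      * b ^ 6 - 880 * b ^ 5 - 516 * b ^ 4 - 528 * b ^ 3 - 116 * b ^ 2 + 592 * b - 80) * hb

/-- An explicit cofactor shows that u³ - 1 divides 63, hence is nonzero in characteristic 0. -/
theorem xRatio_pow_three_sub_one_mul (ha : 1 + a + a ^ 2 = 0) (hb : 1 + b + b ^ 2 + b ^ 3 + b ^ 4 +
    b ^ 5 + b ^ 6 = 0) :
    (xRatio a b ^ 3 - 1) *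
      (16 * a * b ^ 5 + 18 * a * b ^ 4 + 6 * a * b ^ 3 + 8 * a * b ^ 2 + 24 * a * b + 12 * a + 29 *
          b ^ 5 + 30 * b ^ 4 + 24 * b ^ 3 + 25 * b ^ 2 + 12 * b - 15) = 63 := by
  simp only [xRatio]
  linear_combination (434 * a ^ 2 * b ^ 5 + 56 * a ^ 2 * b ^ 4 + 56 * a ^ 2 * b ^ 3 + 434 * a ^ 2 *
      b ^ 2 + 294 * a ^ 2 + 455 * a * b ^ 5 + 434 * a * b ^ 4 - 154 * a * b ^ 3 + 581 * a * b ^ 2 +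
      168 * a * b + 378 * a - 7 * b ^ 5 + 203 * b ^ 4 - 91 * b ^ 3 + 56 * b ^ 2 + 84 * b + 63) * ha
      + (16 * a ^ 4 * b ^ 14 - 94 * a ^ 4 * b ^ 13 + 264 * a ^ 4 * b ^ 12 - 450 * a ^ 4 * b ^ 11 +
      486 * a ^ 4 * b ^ 10 - 324 * a ^ 4 * b ^ 9 + 166 * a ^ 4 * b ^ 8 - 234 * a ^ 4 * b ^ 7 + 422
      * a ^ 4 * b ^ 6 - 378 * a ^ 4 * b ^ 5 + 378 * a ^ 4 * b ^ 3 - 434 * a ^ 4 * b ^ 2 + 294 * a ^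
      4 * b - 294 * a ^ 4 + 125 * a ^ 3 * b ^ 14 - 593 * a ^ 3 * b ^ 13 + 1392 * a ^ 3 * b ^ 12 -
      1986 * a ^ 3 * b ^ 11 + 1770 * a ^ 3 * b ^ 10 - 963 * a ^ 3 * b ^ 9 + 479 * a ^ 3 * b ^ 8 -
      747 * a ^ 3 * b ^ 7 + 1036 * a ^ 3 * b ^ 6 - 507 * a ^ 3 * b ^ 5 - 552 * a ^ 3 * b ^ 4 + 1113
      * a ^ 3 * b ^ 3 - 847 * a ^ 3 * b ^ 2 + 504 * a ^ 3 * b - 672 * a ^ 3 + 366 * a ^ 2 * b ^ 14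
      - 1329 * a ^ 2 * b ^ 13 + 2556 * a ^ 2 * b ^ 12 - 2844 * a ^ 2 * b ^ 11 + 1710 * a ^ 2 * b ^
      10 - 63 * a ^ 2 * b ^ 9 - 606 * a ^ 2 * b ^ 8 + 54 * a ^ 2 * b ^ 7 + 480 * a ^ 2 * b ^ 6 - 54
      * a ^ 2 * b ^ 5 - 951 * a ^ 2 * b ^ 4 + 1296 * a ^ 2 * b ^ 3 - 855 * a ^ 2 * b ^ 2 + 483 * a
      ^ 2 * b - 735 * a ^ 2 + 476 * a * b ^ 14 - 1208 * a * b ^ 13 + 1887 * a * b ^ 12 - 1269 * a *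
      b ^ 11 - 9 * a * b ^ 10 + 1341 * a * b ^ 9 - 1105 * a * b ^ 8 + 180 * a * b ^ 7 + 616 * a * b
      ^ 6 - 99 * a * b ^ 5 - 591 * a * b ^ 4 + 783 * a * b ^ 3 - 304 * a * b ^ 2 + 189 * a * b -
      441 * a + 232 * b ^ 14 - 340 * b ^ 13 + 462 * b ^ 12 + 69 * b ^ 11 - 312 * b ^ 10 + 657 * b ^
      9 - 68 * b ^ 8 - 144 * b ^ 7 + 362 * b ^ 6 + 66 * b ^ 5 - 174 * b ^ 4 + 183 * b ^ 3 - 17 * b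
      ^ 2 + 42 * b - 126) * hb

theorem delta_eq_mul_add (a b : R) :
    delta a b 0 = (132 * b ^ 5 + 168 * b ^ 4 + 24 * b ^ 3 + 60 * b ^ 2 + 192 * b + 96) * a + (120 *
        b ^ 5 + 12 * b ^ 4 - 60 * b ^ 3 + 84 * b ^ 2 + 96 * b - 52) := by
  simp only [delta, Matrix.cons_val_zero]
  ring

/-- Inverts, up to the factor 84, the coefficient of `a` in δ₁, so that `a` can be solved for. -/
theorem delta_coeff_mul (hb : 1 + b + b ^ 2 + b ^ 3 + b ^ 4 + b ^ 5 + b ^ 6 = 0) :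
    (132 * b ^ 5 + 168 * b ^ 4 + 24 * b ^ 3 + 60 * b ^ 2 + 192 * b + 96) *
      (37 * b ^ 5 - 17 * b ^ 4 + 41 * b ^ 3 - 13 * b ^ 2 + 24 * b + 12) = 84 := by
  linear_combination (4884 * b ^ 4 - 912 * b ^ 3 - 528 * b ^ 2 + 3540 * b + 1068) * hb

/-- Recovers `b` from ratios that all lie in any field containing `a` and δ₁. -/
theorem eq_ratio_combination (ha : 1 + a + a ^ 2 = 0) (hb : 1 + b + b ^ 2 + b ^ 3 + b ^ 4 + b ^ 5 +
    b ^ 6 = 0) :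
    1026 * b = (-492 * a + 339) + (40 * a + 206) * xRatio a b + (-182 * a + 140) * xRatio a (b ^ 4)
        + (226 * a - 16) * xRatio a (b ^ 2) + (9 * a + 72) * yRatio a b + (-63 * a + 9) * yRatio a
        (b ^ 4) := by
  rw [xRatio_pow_four hb, xRatio_pow_two hb, yRatio_pow_four hb, xRatio, yRatio]
  linear_combination (684 * b ^ 5 + 684 * b ^ 4 + 684 * b ^ 3 + 684 * b ^ 2 + 1368 * b + 684) * ha

end Ratios

/-! ### Independence and generation in p-torsion -/

section Groups

variable {G : Type*} [AddCommGroup G] {P Q : G}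

/-- If p did not divide `b`, a Bézout relation would invert it modulo p and express Q as a multiple
of P. -/
theorem dvd_of_zsmul_add_zsmul_eq_zero {p : ℕ} [hp : Fact p.Prime] (hP : p • P = 0)
    (hQ : p • Q = 0) (hP0 : P ≠ 0) (hPQ : ∀ k : ℤ, Q ≠ k • P) {a b : ℤ}
    (h : a • P + b • Q = 0) : (p : ℤ) ∣ a ∧ (p : ℤ) ∣ b := by
  have hprime : Prime (p : ℤ) := Nat.prime_iff_prime_int.1 hp.out
  have hQ' : (p : ℤ) • Q = 0 := by rw [natCast_zsmul, hQ]
  have hb : (p : ℤ) ∣ b := by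
    by_contra hb
    obtain ⟨u, v, huv⟩ := (hprime.coprime_iff_not_dvd.2 hb).symm
    apply hPQ (-(u * a))
    calc Q = (u * b + v * p) • Q := by rw [huv, one_zsmul]
      _ = u • (a • P + b • Q) - (u * a) • P + v • (p : ℤ) • Q := by module
      _ = _ := by rw [h, hQ']; module
  refine ⟨?_, hb⟩
  obtain ⟨m, rfl⟩ := hb
  have ha : a • P = 0 := by
    rwa [mul_comm, mul_zsmul, hQ', zsmul_zero, add_zero] at h
  rw [← addOrderOf_eq_prime hP hP0]
  exact addOrderOf_dvd_iff_zsmul_eq_zero.2 ha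

/-- Two independent elements of order `p` span the `p`-torsion when it has at most `p ^ 2`
elements. -/
theorem exists_eq_zsmul_add_zsmul {p : ℕ} [NeZero p] (hP : p • P = 0)
    (hQ : p • Q = 0) (hPQ : ∀ a b : ℤ, a • P + b • Q = 0 → (p : ℤ) ∣ a ∧ (p : ℤ) ∣ b)
    (S : Finset G) (hS : S.card ≤ p ^ 2) (hTS : ∀ T : G, p • T = 0 → T ∈ S) {T : G}
    (hT : p • T = 0) : ∃ a b : ℤ, T = a • P + b • Q := by
  classical
  let f : Fin p × Fin p → G := fun i ↦ (i.1 : ℤ) • P + (i.2 : ℤ) • Q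
  have hf : Function.Injective f := by
    rintro ⟨i, j⟩ ⟨i', j'⟩ h
    have key := hPQ ((i : ℤ) - i') ((j : ℤ) - j') <| by
      rw [← sub_eq_zero] at h
      rw [← h]
      module
    have aux (m n : Fin p) (h : (p : ℤ) ∣ (m : ℤ) - n) : m = n := by
      have := Int.eq_zero_of_abs_lt_dvd h (by rw [abs_lt]; omega)
      omega
    rw [aux _ _ key.1, aux _ _ key.2]
  have himage : Finset.univ.image f ⊆ S := by
    intro R hR
    obtain ⟨i, -, rfl⟩ := Finset.mem_image.1 hR
    apply hTS
    calc p • ((i.1 : ℤ) • P + (i.2 : ℤ) • Q) = (i.1 : ℤ) • p • P + (i.2 : ℤ) • p • Q := by module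
      _ = 0 := by rw [hP, hQ]; simp
  have hcard : S.card ≤ (Finset.univ.image f).card := by
    rw [Finset.card_image_of_injective _ hf]
    simpa [← sq] using hS
  have hmem := hTS T hT
  rw [← Finset.eq_of_subset_of_card_le himage hcard] at hmem
  obtain ⟨i, -, hi⟩ := Finset.mem_image.1 hmem
  exact ⟨_, _, hi.symm⟩

end Groups

/-! ### At most 49 points of 7-torsion -/

section Torsion

variable {K L : Type*} [Field K] [Field L] [DecidableEq L] [Algebra K L] [CharZero L] {c : K}

theorem exists_finset_seven_torsion (c : K) : ∃ S : Finset (PointsOver (curve c) L), S.card ≤ 7 ^ 2 ∧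
    ∀ T : PointsOver (curve c) L, 7 • T = 0 → T ∈ S := by
  classical
  let W := (curve c).baseChange L
  let roots := (W.preΨ' 7).roots.toFinset
  have hne : W.preΨ' 7 ≠ 0 := W.preΨ'_ne_zero (by norm_num)
  have hroots : roots.card ≤ 24 := by
    refine (Multiset.toFinset_card_le _).trans ((Polynomial.card_roots' _).trans ?_)
    refine (W.natDegree_preΨ'_le 7).trans ?_
    rw [if_neg (by decide)]
    norm_num
  -- One point per abscissa suffices, as the only other candidate is its opposite; 0 is a dummy
  -- value when no point lies above `r`.
  have hs (r : L) : ∃ P : PointsOver (curve c) L, ∀ y h,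
      (Affine.Point.some r y h : PointsOver (curve c) L) = P ∨
      (Affine.Point.some r y h : PointsOver (curve c) L) = -P := by
    by_cases hr : ∃ y, W.toAffine.Nonsingular r y
    · obtain ⟨y, h⟩ := hr
      exact ⟨Affine.Point.some r y h, fun y' h' ↦ Affine.Point.X_eq_iff.1 rfl⟩
    · exact ⟨0, fun y h ↦ (hr ⟨y, h⟩).elim⟩
  choose s hs using hs
  refine ⟨insert 0 (roots.image s ∪ roots.image fun r ↦ -s r), ?_, ?_⟩
  · have h1 := Finset.card_insert_le (0 : PointsOver (curve c) L)
      (roots.image s ∪ roots.image fun r ↦ -s r)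
    have h2 := Finset.card_union_le (roots.image s) (roots.image fun r ↦ -s r)
    have h3 : (roots.image s).card ≤ roots.card := Finset.card_image_le
    have h4 : (roots.image fun r ↦ -s r).card ≤ roots.card := Finset.card_image_le
    omega
  · rintro (_ | ⟨x, y, h⟩) hT
    · exact Finset.mem_insert_self _ _
    · have hx : x ∈ roots := by
        rw [Multiset.mem_toFinset, Polynomial.mem_roots hne]
        exact eval_preΨ'_seven_eq_zero h hT
      refine Finset.mem_insert_of_mem (Finset.mem_union.2 ?_)
      rcases hs x y h with h' | h' <;> rw [h']
      · exact Or.inl (Finset.mem_image_of_mem _ hx)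
      · exact Or.inr (Finset.mem_image_of_mem (fun r ↦ -s r) hx)

end Torsion

/-! ### Nonvanishing, and recovering one root of unity from δ and the other -/

section Delta

variable {L : Type*} [Field L] [CharZero L] {a b : L}

omit [CharZero L] in
theorem one_add_add_sq_eq_zero (ha : IsPrimitiveRoot a 3) : 1 + a + a ^ 2 = 0 := by
  simpa [Finset.sum_range_succ] using ha.geom_sum_eq_zero (by norm_num)

omit [CharZero L] in
theorem sum_pow_lt_seven_eq_zero (hb : IsPrimitiveRoot b 7) :
    1 + b + b ^ 2 + b ^ 3 + b ^ 4 + b ^ 5 + b ^ 6 = 0 := by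
  simpa [Finset.sum_range_succ] using hb.geom_sum_eq_zero (by norm_num)

omit [CharZero L] in
theorem pow_four_pow_four (hb : IsPrimitiveRoot b 7) : (b ^ 4) ^ 4 = b ^ 2 := by
  have := hb.pow_eq_one
  linear_combination (b ^ 9 + b ^ 2) * this

theorem delta_add_one_ne_zero (ha : IsPrimitiveRoot a 3) (hb : IsPrimitiveRoot b 7) :
    delta a b 0 + 1 ≠ 0 := by
  intro h
  have h1 := xRatio_spec (one_add_add_sq_eq_zero ha) (sum_pow_lt_seven_eq_zero hb)
  have : (9 : L) = 0 := by linear_combination h1 + (1 - 4 * xRatio a b) * h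
  norm_num at this

/-- If δ vanished, so would its conjugates along the doubling orbit; each ratio would then be -8/4 =
-2, with product -8 instead of 1. -/
theorem delta_ne_zero (ha : IsPrimitiveRoot a 3) (hb : IsPrimitiveRoot b 7) :
    delta a b 0 ≠ 0 := by
  have hsa := one_add_add_sq_eq_zero ha
  have aux {b : L} (hb : IsPrimitiveRoot b 7) (h : delta a b 0 = 0) :
      xRatio a b = -2 ∧ delta a (b ^ 4) 0 = 0 := by
    have hsb := sum_pow_lt_seven_eq_zero hb
    have h1 := xRatio_spec hsa hsb
    have h2 := delta_pow_four hsa hsb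
    rw [h] at h1 h2
    exact ⟨by linear_combination h1 / 4, by simpa using h2⟩
  intro h
  have hb4 := hb.pow_of_coprime 4 (by norm_num)
  have hb2 := hb.pow_of_coprime 2 (by norm_num)
  obtain ⟨h1, h'⟩ := aux hb h
  obtain ⟨h2, h''⟩ := aux hb4 h'
  rw [pow_four_pow_four hb] at h''
  have h3 := (aux hb2 h'').1
  have := xRatio_mul_mul hsa (sum_pow_lt_seven_eq_zero hb)
  rw [h1, h2, h3] at this
  norm_num at this

theorem xRatio_pow_three_ne_one (ha : IsPrimitiveRoot a 3) (hb : IsPrimitiveRoot b 7) :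
    xRatio a b ^ 3 ≠ 1 := by
  intro h
  have := xRatio_pow_three_sub_one_mul (one_add_add_sq_eq_zero ha) (sum_pow_lt_seven_eq_zero hb)
  rw [h, sub_self, zero_mul] at this
  norm_num at this

/-- `ζ₇` lies in every field containing `ζ₃` and `δ₁`. -/
theorem zeta_seven_mem_of_delta_mem {K : Type*} [Field K] [Algebra K L] (F : IntermediateField K L)
    (ha : IsPrimitiveRoot a 3) (hb : IsPrimitiveRoot b 7) (haF : a ∈ F)
    (hd : delta a b 0 ∈ F) : b ∈ F := by
  have hsa := one_add_add_sq_eq_zero ha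
  have aux {b : L} (hb : IsPrimitiveRoot b 7) (h : delta a b 0 ∈ F) :
      xRatio a b ∈ F ∧ yRatio a b ∈ F ∧ delta a (b ^ 4) 0 ∈ F := by
    have hsb := sum_pow_lt_seven_eq_zero hb
    have h0 := delta_add_one_ne_zero ha hb
    have h1 : xRatio a b ∈ F := by
      rw [eq_div_of_mul_eq (mul_ne_zero (by norm_num) h0)
        ((mul_comm _ _).trans (xRatio_spec hsa hsb))]
      exact div_mem (sub_mem h (ofNat_mem F 8))
        (mul_mem (ofNat_mem F 4) (add_mem h (one_mem F)))
    refine ⟨h1, ?_, ?_⟩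
    · rw [eq_div_of_mul_eq (mul_ne_zero two_ne_zero h0)
        ((mul_comm _ _).trans (yRatio_spec hsa hsb))]
      exact div_mem (sub_mem (mul_mem (neg_mem (ofNat_mem F 2)) (add_mem h (one_mem F)))
        (mul_mem (mul_mem (ofNat_mem F 3) h) (sub_mem h1 (one_mem F))))
        (mul_mem (ofNat_mem F 2) (add_mem h (one_mem F)))
    · rw [delta_pow_four hsa hsb]
      exact mul_mem h (pow_mem h1 3)
  obtain ⟨hx, hy, hd4⟩ := aux hb hd
  obtain ⟨hx4, hy4, hd2⟩ := aux (hb.pow_of_coprime 4 (by norm_num)) hd4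
  rw [pow_four_pow_four hb] at hd2
  obtain ⟨hx2, -, -⟩ := aux (hb.pow_of_coprime 2 (by norm_num)) hd2
  have key := eq_ratio_combination hsa (sum_pow_lt_seven_eq_zero hb)
  rw [eq_div_of_mul_eq (by norm_num) ((mul_comm _ _).trans key)]
  refine div_mem ?_ (ofNat_mem F 1026)
  repeat' first
    | assumption
    | exact ofNat_mem F _
    | apply pow_mem
    | apply neg_mem
    | apply add_mem
    | apply sub_mem
    | apply mul_mem

/-- `ζ₃` lies in every field containing `ζ₇` and `δ₁`. -/
theorem zeta_three_mem_of_delta_mem {K : Type*} [Field K] [Algebra K L] (F : IntermediateField K L)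
    (hb : IsPrimitiveRoot b 7) (hbF : b ∈ F)
    (hd : delta a b 0 ∈ F) : a ∈ F := by
  have h84 : (84 : L) ≠ 0 := by norm_num
  have key : a * 84 = (delta a b 0 - (120 * b ^ 5 + 12 * b ^ 4 - 60 * b ^ 3 + 84 * b ^ 2 + 96 * b
      - 52)) * (37 * b ^ 5 - 17 * b ^ 4 + 41 * b ^ 3 - 13 * b ^ 2 + 24 * b + 12) := by
    rw [delta_eq_mul_add, ← delta_coeff_mul (sum_pow_lt_seven_eq_zero hb)]
    ring
  rw [eq_div_of_mul_eq h84 key]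
  refine div_mem ?_ (ofNat_mem F 84)
  repeat' first
    | assumption
    | exact ofNat_mem F _
    | apply pow_mem
    | apply neg_mem
    | apply add_mem
    | apply sub_mem
    | apply mul_mem

end Delta

/-! ### The multiples of P and independence from ζ₃P -/

section Multiples

variable {K L : Type*} [Field K] [Field L] [DecidableEq L] [Algebra K L] [CharZero L] {c : K}
  {a b x y : L}

theorem two_nsmul_some_of_delta (hc : c ≠ 0) (ha : IsPrimitiveRoot a 3) (hb : IsPrimitiveRoot b 7)
    (hx : x ^ 3 = delta a b 0 * algebraMap K L c)
    (hy : y ^ 2 = (delta a b 0 + 1) * algebraMap K L c)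
    (h : ((curve c).baseChange L).toAffine.Nonsingular x y) :
    ∃ h' : ((curve c).baseChange L).toAffine.Nonsingular (x * xRatio a b) (y * yRatio a b),
      2 • (Affine.Point.some x y h : PointsOver (curve c) L) =
        Affine.Point.some (x * xRatio a b) (y * yRatio a b) h' ∧
      (x * xRatio a b) ^ 3 = delta a (b ^ 4) 0 * algebraMap K L c ∧
      (y * yRatio a b) ^ 2 = (delta a (b ^ 4) 0 + 1) * algebraMap K L c := by
  have hsa := one_add_add_sq_eq_zero ha
  have hsb := sum_pow_lt_seven_eq_zero hb
  have hC : algebraMap K L c ≠ 0 := by simpa using hc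
  have hd := delta_add_one_ne_zero ha hb
  have hy0 : y ≠ 0 := by
    rintro rfl
    exact mul_ne_zero hd hC (by simpa using hy.symm)
  have hu := xRatio_spec hsa hsb
  have hv := yRatio_spec hsa hsb
  have hlx : x * xRatio a b = (3 * x ^ 2 / (2 * y)) ^ 2 - 2 * x := by
    have : 4 * y ^ 2 * (x * xRatio a b) = 9 * x ^ 4 - 8 * y ^ 2 * x := by
      rw [show x ^ 4 = x ^ 3 * x by ring, hx, hy]
      linear_combination x * algebraMap K L c * hu
    field_simp
    linear_combination this
  have hly : y * yRatio a b = 3 * x ^ 2 / (2 * y) * (x - x * xRatio a b) - y := by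
    have : 2 * y ^ 2 * yRatio a b = 3 * x ^ 3 * (1 - xRatio a b) - 2 * y ^ 2 := by
      rw [hx, hy]
      linear_combination algebraMap K L c * hv
    field_simp
    linear_combination this
  obtain ⟨h', h2⟩ := two_nsmul_some h hy0 (by field_simp) hlx hly
  have hx' : (x * xRatio a b) ^ 3 = delta a (b ^ 4) 0 * algebraMap K L c := by
    rw [mul_pow, hx, delta_pow_four hsa hsb]
    ring
  refine ⟨h', h2, hx', ?_⟩
  rw [equation_curve_iff.1 h'.1, hx']
  ring

theorem four_and_eight_nsmul_some_of_delta (hc : c ≠ 0) (ha : IsPrimitiveRoot a 3)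
    (hb : IsPrimitiveRoot b 7)
    (hx : x ^ 3 = delta a b 0 * algebraMap K L c)
    (hy : y ^ 2 = (delta a b 0 + 1) * algebraMap K L c)
    (h : ((curve c).baseChange L).toAffine.Nonsingular x y) :
    (∃ x' y' h', 4 • (Affine.Point.some x y h : PointsOver (curve c) L) =
      Affine.Point.some x' y' h' ∧ x' * xRatio a (b ^ 2) = x) ∧
    8 • (Affine.Point.some x y h : PointsOver (curve c) L) = Affine.Point.some x y h := by
  have hsa := one_add_add_sq_eq_zero ha
  have hsb := sum_pow_lt_seven_eq_zero hb
  obtain ⟨h₁, e₁, hx₁, hy₁⟩ := two_nsmul_some_of_delta hc ha hb hx hy h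
  obtain ⟨h₂, e₂, hx₂, hy₂⟩ :=
    two_nsmul_some_of_delta hc ha (hb.pow_of_coprime 4 (by norm_num)) hx₁ hy₁ h₁
  rw [pow_four_pow_four hb] at hx₂ hy₂
  obtain ⟨h₃, e₃, -, -⟩ :=
    two_nsmul_some_of_delta hc ha (hb.pow_of_coprime 2 (by norm_num)) hx₂ hy₂ h₂
  have hX : x * xRatio a b * xRatio a (b ^ 4) * xRatio a (b ^ 2) = x := by
    linear_combination x * xRatio_mul_mul hsa hsb
  have hY : y * yRatio a b * yRatio a (b ^ 4) * yRatio a (b ^ 2) = y := by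
    linear_combination y * yRatio_mul_mul hsa hsb
  refine ⟨⟨_, _, h₂, ?_, hX⟩, ?_⟩
  · rw [← e₂, ← e₁, ← mul_nsmul]
  · simp only [hX, hY] at e₃
    refine Eq.trans ?_ e₃
    rw [← e₂, ← e₁, ← mul_nsmul, ← mul_nsmul]

theorem seven_nsmul_some_of_delta (hc : c ≠ 0) (ha : IsPrimitiveRoot a 3)
    (hb : IsPrimitiveRoot b 7)
    (hx : x ^ 3 = delta a b 0 * algebraMap K L c)
    (hy : y ^ 2 = (delta a b 0 + 1) * algebraMap K L c)
    (h : ((curve c).baseChange L).toAffine.Nonsingular x y) :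
    7 • (Affine.Point.some x y h : PointsOver (curve c) L) = 0 := by
  have h8 := (four_and_eight_nsmul_some_of_delta hc ha hb hx hy h).2
  rwa [show 8 = 7 + 1 from rfl, succ_nsmul, add_eq_right] at h8

theorem cm_ne_zsmul (hc : c ≠ 0) (ha : IsPrimitiveRoot a 3) (hb : IsPrimitiveRoot b 7)
    (hx : x ^ 3 = delta a b 0 * algebraMap K L c)
    (hy : y ^ 2 = (delta a b 0 + 1) * algebraMap K L c)
    (h : ((curve c).baseChange L).toAffine.Nonsingular x y)
    (h' : ((curve c).baseChange L).toAffine.Nonsingular (a * x) y) (k : ℤ) :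
    (Affine.Point.some (a * x) y h' : PointsOver (curve c) L) ≠ k • Affine.Point.some x y h := by
  have hC : algebraMap K L c ≠ 0 := by simpa using hc
  have hx0 : x ≠ 0 := by
    rintro rfl
    exact mul_ne_zero (delta_ne_zero ha hb) hC (by simpa using hx.symm)
  have h7 := seven_nsmul_some_of_delta hc ha hb hx hy h
  obtain ⟨⟨x₄, y₄, h₄, e₄, hx₄⟩, -⟩ := four_and_eight_nsmul_some_of_delta hc ha hb hx hy h
  obtain ⟨h₂, e₂, -, -⟩ := two_nsmul_some_of_delta hc ha hb hx hy h
  obtain ⟨P, hP⟩ : ∃ P : PointsOver (curve c) L, P = Affine.Point.some x y h := ⟨_, rfl⟩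
  obtain ⟨Q, hQ⟩ : ∃ Q : PointsOver (curve c) L, Q = Affine.Point.some (a * x) y h' := ⟨_, rfl⟩
  rw [← hP] at h7 e₂ e₄ ⊢
  rw [← hQ]
  have n1 : ¬(Q = P ∨ Q = -P) := by
    rw [hP, hQ, ← Affine.Point.X_eq_iff]
    exact fun e ↦ ha.ne_one (by norm_num) (mul_right_cancel₀ hx0 (e.trans (one_mul x).symm))
  have n2 : ¬(Q = 2 • P ∨ Q = -(2 • P)) := by
    rw [e₂, hQ, ← Affine.Point.X_eq_iff, mul_comm]
    intro e
    apply xRatio_pow_three_ne_one ha hb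
    rw [← mul_left_cancel₀ hx0 e, ha.pow_eq_one]
  -- Here P = 2(4P) is used: the ratio from 4P back to P is `xRatio a (b ^ 2)`, which would be the
  -- inverse of `a`.
  have n4 : ¬(Q = 4 • P ∨ Q = -(4 • P)) := by
    rw [e₄, hQ, ← Affine.Point.X_eq_iff]
    intro e
    apply xRatio_pow_three_ne_one ha (hb.pow_of_coprime 2 (by norm_num))
    rw [← e] at hx₄
    have : a * xRatio a (b ^ 2) = 1 := mul_right_cancel₀ hx0 (by linear_combination hx₄)
    have := congrArg (· ^ 3) this
    simpa [mul_pow, ha.pow_eq_one] using this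
  have hk : k • P = (k % 7) • P := by
    conv_lhs => rw [← Int.emod_add_mul_ediv k 7, mul_comm, add_zsmul, mul_zsmul]
    have : (7 : ℤ) • P = 0 := by rw [← h7]; norm_cast
    rw [this, zsmul_zero, add_zero]
  rw [hk]
  have h0 := Int.emod_nonneg k (show (7 : ℤ) ≠ 0 by norm_num)
  have h1 := Int.emod_lt_of_pos k (show (0 : ℤ) < 7 by norm_num)
  generalize k % 7 = r at h0 h1
  intro e
  -- Turns the residues 3, 5, 6 into the opposites of 4, 2, 1.
  have e7 (m : ℤ) : m • P = -((7 - m) • P) := by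
    calc m • P = 7 • P - (7 - m) • P := by module
      _ = _ := by rw [h7, zero_sub]
  interval_cases r
  · rw [zero_zsmul, hQ] at e
    exact Affine.Point.some_ne_zero _ e
  · exact n1 (.inl (by simpa using e))
  · exact n2 (.inl (by rw [e]; norm_cast))
  · exact n4 (.inr (by rw [e, e7]; norm_cast))
  · exact n4 (.inl (by rw [e]; norm_cast))
  · exact n2 (.inr (by rw [e, e7]; norm_cast))
  · exact n1 (.inr (by rw [e, e7]; simp))

end Multiples

/-! ### Fields of definition of the torsion -/

section Fields

variable {K L : Type*} [Field K] [Field L] [DecidableEq L] [Algebra K L] {c : K}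
  {x y x' y' : L}

/-- If two points with coordinates in `F` generate the `m`-torsion, then `F` contains the
`m`-th division field. -/
theorem divisionField_le (F : IntermediateField K L) {m : ℕ}
    (h : ((curve c).baseChange L).toAffine.Nonsingular x y)
    (h' : ((curve c).baseChange L).toAffine.Nonsingular x' y')
    (hxF : x ∈ F) (hyF : y ∈ F) (hxF' : x' ∈ F) (hyF' : y' ∈ F)
    (hspan : ∀ T : PointsOver (curve c) L, m • T = 0 →
      ∃ a b : ℤ, T = a • Affine.Point.some x y h + b • Affine.Point.some x' y' h') :
    divisionField (curve c) L m ≤ F := by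
  have lift {u v : L} (hu : u ∈ F) (hv : v ∈ F)
      (h : ((curve c).baseChange L).toAffine.Nonsingular u v) :
      ∃ R : PointsOver (curve c) F, Affine.Point.map F.val R = Affine.Point.some u v h :=
    ⟨Affine.Point.some ⟨u, hu⟩ ⟨v, hv⟩
      ((Affine.baseChange_nonsingular (curve c) F.val.injective ..).1 h), rfl⟩
  obtain ⟨P, hP⟩ := lift hxF hyF h
  obtain ⟨Q, hQ⟩ := lift hxF' hyF' h'
  refine IntermediateField.adjoin_le_iff.2 ?_
  rintro t ⟨u, v, huv, hm, ht⟩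
  obtain ⟨a, b, hab⟩ := hspan _ hm
  -- The combination can be formed in the group of `F`-points, so its coordinates lie in `F`.
  rw [← hP, ← hQ, ← map_zsmul, ← map_zsmul, ← map_add] at hab
  obtain ⟨R, hR⟩ : ∃ R, R = a • P + b • Q := ⟨_, rfl⟩
  rw [← hR] at hab
  rcases R with _ | ⟨r, s, hrs⟩
  · exact (Affine.Point.some_ne_zero _ hab).elim
  · rw [Affine.Point.map_some, Affine.Point.some.injEq] at hab
    rcases ht with rfl | rfl
    · exact hab.1 ▸ r.2
    · exact hab.2 ▸ s.2

end Fields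
end DivisionField

/-! ### The main theorem -/

theorem theorem4 {K : Type*} [Field K] [NumberField K]
    {L : Type*} [Field L] [DecidableEq L] [Algebra K L] [IsAlgClosure K L]
    (c : K) (hc : c ≠ 0)
    (ζ₃ ζ₇ : L) (hζ₃ : IsPrimitiveRoot ζ₃ 3) (hζ₇ : IsPrimitiveRoot ζ₇ 7)
    (j : Fin 6) (x y : L)
    (hx : x ^ 3 = DivisionField.delta ζ₃ ζ₇ j * algebraMap K L c)
    (hy : y ^ 2 = (DivisionField.delta ζ₃ ζ₇ j + 1) * algebraMap K L c) :
    DivisionField.divisionField (DivisionField.curve c) L 7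
        = IntermediateField.adjoin K {x, ζ₃, y} ∧
    DivisionField.divisionField (DivisionField.curve c) L 7
        = IntermediateField.adjoin K {x, ζ₇, y} ∧
    (((DivisionField.curve c).baseChange L).preΨ' 7).eval x = 0 ∧
    ∃ h : ((DivisionField.curve c).baseChange L).toAffine.Nonsingular x y,
      ∀ P : DivisionField.PointsOver (DivisionField.curve c) L,
        P = WeierstrassCurve.Affine.Point.some x y h →
        (∀ a b : ℤ, a • P + b • DivisionField.cm c ζ₃ hζ₃.pow_eq_one P = 0 →
          (7 : ℤ) ∣ a ∧ (7 : ℤ) ∣ b) ∧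
        (∀ T : DivisionField.PointsOver (DivisionField.curve c) L,
          7 • T = 0 ↔
            ∃ a b : ℤ, T = a • P + b • DivisionField.cm c ζ₃ hζ₃.pow_eq_one P) := by
  open DivisionField WeierstrassCurve in
  have : CharZero L := charZero_of_injective_algebraMap (algebraMap K L).injective
  have : Fact (Nat.Prime 7) := ⟨by norm_num⟩
  have hC : algebraMap K L c ≠ 0 := by simpa using hc
  rw [delta_eq_delta_zero (sum_pow_lt_seven_eq_zero hζ₇)] at hx hy
  have hb := hζ₇.pow_of_coprime _ (deltaExponent_coprime j)
  -- ζ₇ is in turn a power of the new root, so a field contains one as soon as it contains the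
  -- other.
  obtain ⟨k, hk⟩ : ∃ k, (ζ₇ ^ deltaExponent j) ^ k = ζ₇ := by
    obtain ⟨i, -, hi⟩ := hb.eq_pow_of_pow_eq_one hζ₇.pow_eq_one
    exact ⟨i, hi⟩
  generalize hbdef : ζ₇ ^ deltaExponent j = b at hx hy hb hk
  have hx0 : x ≠ 0 := by
    rintro rfl
    exact mul_ne_zero (delta_ne_zero hζ₃ hb) hC (by simpa using hx.symm)
  have hmem (F : IntermediateField K L) (hxF : x ∈ F) : delta ζ₃ b 0 ∈ F := by
    rw [eq_div_of_mul_eq hC hx.symm]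
    exact div_mem (pow_mem hxF 3) (F.algebraMap_mem c)
  have h : ((curve c).baseChange L).toAffine.Nonsingular x y := by
    rw [nonsingular_curve_iff hc, hx, hy]
    ring
  have h' : ((curve c).baseChange L).toAffine.Nonsingular (ζ₃ * x) y :=
    nonsingular_mul hζ₃.pow_eq_one h
  have hx' : (ζ₃ * x) ^ 3 = delta ζ₃ b 0 * algebraMap K L c := by
    rw [mul_pow, hζ₃.pow_eq_one, one_mul, hx]
  have hP := seven_nsmul_some_of_delta hc hζ₃ hb hx hy h
  have hQ := seven_nsmul_some_of_delta hc hζ₃ hb hx' hy h'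
  have hind : ∀ a b : ℤ, a • (Affine.Point.some x y h : PointsOver (curve c) L) +
      b • (Affine.Point.some (ζ₃ * x) y h' : PointsOver (curve c) L) = 0 →
      ((7 : ℕ) : ℤ) ∣ a ∧ ((7 : ℕ) : ℤ) ∣ b := fun a b' ↦
    dvd_of_zsmul_add_zsmul_eq_zero hP hQ (Affine.Point.some_ne_zero _)
      (cm_ne_zsmul hc hζ₃ hb hx hy h h')
  obtain ⟨S, hS, hTS⟩ := exists_finset_seven_torsion (L := L) c
  have hspan (T : PointsOver (curve c) L) (hT : 7 • T = 0) :=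
    exists_eq_zsmul_add_zsmul hP hQ hind S hS hTS hT
  have hfield : divisionField (curve c) L 7 = IntermediateField.adjoin K {x, ζ₃, y} := by
    apply le_antisymm
    · have hmem : ∀ z ∈ ({x, ζ₃, y} : Set L), z ∈ IntermediateField.adjoin K {x, ζ₃, y} :=
        fun z hz ↦ IntermediateField.subset_adjoin K _ hz
      exact divisionField_le (IntermediateField.adjoin K {x, ζ₃, y}) h h' (hmem x (by simp))
        (hmem y (by simp)) (mul_mem (hmem ζ₃ (by simp)) (hmem x (by simp))) (hmem y (by simp)) hspan
    · have hxy : x ∈ divisionField (curve c) L 7 ∧ y ∈ divisionField (curve c) L 7 :=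
        ⟨IntermediateField.subset_adjoin K _ ⟨x, y, h, hP, .inl rfl⟩,
          IntermediateField.subset_adjoin K _ ⟨x, y, h, hP, .inr rfl⟩⟩
      have hzx : ζ₃ * x ∈ divisionField (curve c) L 7 :=
        IntermediateField.subset_adjoin K _ ⟨ζ₃ * x, y, h', hQ, .inl rfl⟩
      refine IntermediateField.adjoin_le_iff.2 ?_
      rintro z (rfl | rfl | rfl)
      · exact hxy.1
      -- ζ₃ is the quotient of the abscissas of φ₂(P) and P.
      · simpa [hx0] using div_mem hzx hxy.1
      · exact hxy.2
  have hfields : IntermediateField.adjoin K {x, ζ₃, y} = IntermediateField.adjoin K {x, ζ₇, y} := by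
    apply le_antisymm
    · have hmem' : ∀ z ∈ ({x, ζ₇, y} : Set L), z ∈ IntermediateField.adjoin K {x, ζ₇, y} :=
        fun z hz ↦ IntermediateField.subset_adjoin K _ hz
      refine IntermediateField.adjoin_le_iff.2 ?_
      rintro z (rfl | rfl | rfl)
      · exact hmem' _ (by simp)
      · exact zeta_three_mem_of_delta_mem _ hb (hbdef ▸ pow_mem (hmem' ζ₇ (by simp)) _)
          (hmem _ (hmem' x (by simp)))
      · exact hmem' _ (by simp)
    · have hmem' : ∀ z ∈ ({x, ζ₃, y} : Set L), z ∈ IntermediateField.adjoin K {x, ζ₃, y} :=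
        fun z hz ↦ IntermediateField.subset_adjoin K _ hz
      refine IntermediateField.adjoin_le_iff.2 ?_
      rintro z (rfl | rfl | rfl)
      · exact hmem' _ (by simp)
      · rw [SetLike.mem_coe, ← hk]
        exact pow_mem (zeta_seven_mem_of_delta_mem _ hζ₃ hb (hmem' ζ₃ (by simp))
          (hmem _ (hmem' x (by simp)))) _
      · exact hmem' _ (by simp)
  refine ⟨hfield, hfield.trans hfields, eval_preΨ'_seven_eq_zero h hP, h, ?_⟩
  rintro P rfl
  refine ⟨hind, fun T ↦ ⟨hspan T, ?_⟩⟩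
  rintro ⟨a, b, rfl⟩
  rw [nsmul_add, smul_comm, smul_comm 7 b]
  exact (congrArg₂ (a • · + b • ·) hP hQ).trans (by simp)
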